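/- Let $m,n,k$ be nonnegative integers, let $\mathbf{X}$ be a random matrix in $\mathbb{R}^{m\times n}$ of arbitrary distribution, and equip $\mathbb{R}^{m\times n}$ with the trace inner product $\langle A,B\rangle=\operatorname{tr}(A^{\mathsf T}B)$ and the norm $\|A\|_2=\sqrt{\langle A,A\rangle}$. Let $\varepsilon\ge 0$, and let $S\subseteq\mathbb{R}^{m\times n}$ be an $\varepsilon$-support set of $\mathbf{X}$, i.e., a nonempty bounded set with $\Pr[\mathbf{X}\in S]\ge 1-\varepsilon$. For $\rho>0$ let $N_S(\rho)$ be the smallest number of open balls of radius $\rho$ with centers in $\mathbb{R}^{m\times n}$ that cover $S$, and let $$\underline{\dim}_{\mathrm B}(S)=\liminf_{\rho\to 0^+}\frac{\log N_S(\rho)}{\log (1/\rho)}$$ be the lower Minkowski dimension of $S$. If $k>\underline{\dim}_{\mathrm B}(S)$, then for Lebesgue almost all $(a_1,\dots,a_k,b_1,\dots,b_k)\in(\mathbb{R}^m)^k\times(\mathbb{R}^n)^k$, with the corresponding rank-one measurement matrices $A_i=a_ib_i^{\mathsf T}$, $i=1,\dots,k$, there exists a (Borel) measurable decoder $g:\mathbb{R}^k\to\mathbb{R}^{m\times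 n}$ such that $$\Pr\bigl[g\bigl(\langle A_1,\mathbf{X}\rangle,\dots,\langle A_k,\mathbf{X}\rangle\bigr)\neq\mathbf{X}\bigr]\le\varepsilon .$$ -/

import Mathlib

open MeasureTheory Filter Topology

/- `‖A‖` is the Euclidean (Frobenius) norm of a real matrix, with its metric and bornology. -/
attribute [local instance] Matrix.frobeniusNormedAddCommGroup

noncomputable section

namespace MatrixCompletion

/-- Matrices carry the Borel sigma-algebra. -/
instance matrixMeasurableSpace {m n : ℕ} : MeasurableSpace (Matrix (Fin m) (Fin n) ℝ) :=
  borel (Matrix (Fin m) (Fin n) ℝ)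

instance matrixBorelSpace {m n : ℕ} : BorelSpace (Matrix (Fin m) (Fin n) ℝ) := ⟨rfl⟩

/-- The trace inner product `⟨A, B⟩ = tr (Aᵀ B)`. -/
def traceInner {m n : ℕ} (A B : Matrix (Fin m) (Fin n) ℝ) : ℝ :=
  (A.transpose * B).trace

/-- The vector of linear measurements `(⟨A₁, X⟩, …, ⟨A_k, X⟩)`. -/
def measurements {m n k : ℕ} (A : Fin k → Matrix (Fin m) (Fin n) ℝ)
    (X : Matrix (Fin m) (Fin n) ℝ) : Fin k → ℝ :=
  fun i => traceInner (A i) X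

/-- The rank-one matrices `A_i = a_i b_iᵀ`. -/
def rankOne {m n k : ℕ} (a : Fin k → Fin m → ℝ) (b : Fin k → Fin n → ℝ) :
    Fin k → Matrix (Fin m) (Fin n) ℝ :=
  fun i => Matrix.vecMulVec (a i) (b i)

/-- A decoder `g` achieves error probability `ε` for the measurement matrices `A_i`. -/
def AchievesErrorProbability {Ω : Type*} [MeasurableSpace Ω] (P : Measure Ω) {m n k : ℕ}
    (X : Ω → Matrix (Fin m) (Fin n) ℝ) (A : Fin k → Matrix (Fin m) (Fin n) ℝ)
    (g : (Fin k → ℝ) → Matrix (Fin m) (Fin n) ℝ) (ε : ℝ) : Prop :=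
  P.real {ω | g (measurements A (X ω)) ≠ X ω} ≤ ε

/-- `S` is an `ε`-support set of the random matrix `X`. -/
structure IsSupportSet {Ω : Type*} [MeasurableSpace Ω] (P : Measure Ω) {m n : ℕ}
    (X : Ω → Matrix (Fin m) (Fin n) ℝ) (ε : ℝ) (S : Set (Matrix (Fin m) (Fin n) ℝ)) : Prop where
  nonempty : S.Nonempty
  isBounded : Bornology.IsBounded S
  one_sub_le : 1 - ε ≤ P.real {ω | X ω ∈ S}

/-- The covering number `N_S(ρ)`: the least number of open balls of radius `ρ`, with arbitrary
centers, that cover `S` (used for bounded `S` and `ρ > 0`, where such a number exists). -/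
def coveringNumber {m n : ℕ} (S : Set (Matrix (Fin m) (Fin n) ℝ)) (ρ : ℝ) : ℕ :=
  sInf {N : ℕ | ∃ M : Fin N → Matrix (Fin m) (Fin n) ℝ, S ⊆ ⋃ i, Metric.ball (M i) ρ}

/-- The lower Minkowski dimension of a nonempty bounded set of matrices, the lower limit being
taken in the extended reals. -/
def lowerMinkowskiDim {m n : ℕ} (S : Set (Matrix (Fin m) (Fin n) ℝ)) : EReal :=
  liminf (fun ρ : ℝ => ((Real.log (coveringNumber S ρ) / Real.log (1 / ρ) : ℝ) : EReal))
    (𝓝[>] (0 : ℝ))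

end MatrixCompletion

end

open scoped ENNReal

namespace MatrixCompletion

/-! Fix `x`. If `v` has an entry of size at least `η`, the bilinear form `aᵀ v b` has bounded `α`-th
negative moment over a cube for every `α < 1`, so by Markov `|aᵀ v b| ≤ δ` has measure `O(δ ^ α)`
(`exists_volume_bilinear_le`), and `k` independent pairs give `O(δ ^ (α k))`. Cover `S` by
`ρ`-balls: the measurements failing to separate `x` from points of `closure S` that are `η`-far in a
given entry have measure `O(N_S(ρ) ρ ^ (α k))`. This tends to `0` along suitable `ρ` when the lower
dimension is below `α k`, which holds for `α` near `1` (`volume_collision_eq_zero`).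

By Tonelli, almost every choice of measurements separates almost every `X` from the rest of `closure
S`. On that Borel set the measurement map is injective, and Lusin–Souslin supplies a Borel inverse.
-/

/-! ### Negative moments and the small-ball estimate -/

theorem ennreal_rpow_neg_anti {α : ℝ} (hα : 0 ≤ α) {x y : ℝ≥0∞} (h : x ≤ y) :
    y ^ (-α) ≤ x ^ (-α) := by
  rw [ENNReal.rpow_neg, ENNReal.rpow_neg]
  exact ENNReal.inv_le_inv.2 (ENNReal.rpow_le_rpow h hα)

/-- A negative power of order less than one is integrable near the origin. -/
theorem lintegral_enorm_rpow_neg_lt_top {α : ℝ} (hα : α < 1) :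
    ∫⁻ t in Set.Ioc (-1 : ℝ) 1, ‖t‖ₑ ^ (-α) < ∞ := by
  have hint : IntervalIntegrable (fun t : ℝ => |t| ^ (-α)) volume (-1) 1 := by
    refine intervalIntegrable_of_even (fun x => by simp) (fun x hx => ?_)
    refine (intervalIntegral.intervalIntegrable_rpow' (by linarith : -1 < -α)).congr
      fun t ht => ?_
    rw [Set.uIoc_of_le hx.le] at ht
    simp only [abs_of_pos ht.1]
  have h := ((intervalIntegrable_iff_integrableOn_Ioc_of_le (by norm_num)).1 hint).lintegral_lt_top
  refine lt_of_le_of_lt (le_of_eq (lintegral_congr_ae ?_)) h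
  filter_upwards [ae_restrict_of_ae (Measure.ae_ne volume (0 : ℝ))] with t ht
  rw [← ENNReal.ofReal_rpow_of_pos (abs_pos.2 ht), Real.enorm_eq_ofReal_abs]

/-- The `α`-th negative moment over an interval of an affine function with slope `w` is at most
`C |w| ^ (-α)`, uniformly in the intercept. -/
theorem exists_lintegral_affine_rpow_neg_le {α : ℝ} (hα₀ : 0 < α) (hα : α < 1) (R : ℝ) :
    ∃ C : ℝ≥0∞, C ≠ 0 ∧ C ≠ ∞ ∧ ∀ w c : ℝ,
      ∫⁻ t in Set.Icc (-R) R, ‖w * t + c‖ₑ ^ (-α) ≤ C * ‖w‖ₑ ^ (-α) := by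
  set J := ∫⁻ t in Set.Ioc (-1 : ℝ) 1, ‖t‖ₑ ^ (-α)
  -- The summand `1` keeps the constant nonzero, so for `w = 0` the right side is `∞`.
  refine ⟨J + volume (Set.Icc (-R) R) + 1, by simp, ?_, fun w c => ?_⟩
  · simp [J, (lintegral_enorm_rpow_neg_lt_top hα).ne]
  rcases eq_or_ne w 0 with rfl | hw
  · simp [ENNReal.zero_rpow_of_neg (neg_lt_zero.2 hα₀), ENNReal.mul_top]
  have key (d : ℝ) : ∫⁻ t in Set.Icc (-R) R, ‖t + d‖ₑ ^ (-α) ≤ J + volume (Set.Icc (-R) R) := by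
    set f : ℝ → ℝ≥0∞ := (Set.Ioc (-1 : ℝ) 1).indicator fun t => ‖t‖ₑ ^ (-α)
    have hpt (t : ℝ) : ‖t‖ₑ ^ (-α) ≤ f t + 1 := by
      by_cases ht : t ∈ Set.Ioc (-1 : ℝ) 1
      · simp [f, ht]
      · refine le_add_left ?_
        refine ENNReal.rpow_le_one_of_one_le_of_neg ?_ (neg_lt_zero.2 hα₀)
        rw [Real.enorm_eq_ofReal_abs, ENNReal.one_le_ofReal]
        by_contra! h
        exact ht ⟨(abs_lt.1 h).1, (abs_lt.1 h).2.le⟩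
    have hf : Measurable f := by
      refine Measurable.indicator ?_ measurableSet_Ioc
      fun_prop
    calc ∫⁻ t in Set.Icc (-R) R, ‖t + d‖ₑ ^ (-α)
        ≤ ∫⁻ t in Set.Icc (-R) R, (f (t + d) + 1) := lintegral_mono fun t => hpt _
      _ = (∫⁻ t in Set.Icc (-R) R, f (t + d)) + volume (Set.Icc (-R) R) := by
        rw [lintegral_add_right _ measurable_const]; simp
      _ ≤ (∫⁻ t, f (t + d)) + volume (Set.Icc (-R) R) := by
        gcongr; exact Measure.restrict_le_self
      _ = J + volume (Set.Icc (-R) R) := by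
        rw [lintegral_add_right_eq_self f d, lintegral_indicator measurableSet_Ioc]
  have hw₀ : ‖w‖ₑ ≠ 0 := by simpa using hw
  calc ∫⁻ t in Set.Icc (-R) R, ‖w * t + c‖ₑ ^ (-α)
      = ∫⁻ t in Set.Icc (-R) R, ‖w‖ₑ ^ (-α) * ‖t + c / w‖ₑ ^ (-α) := by
        refine lintegral_congr fun t => ?_
        rw [← ENNReal.mul_rpow_of_ne_top enorm_ne_top enorm_ne_top, ← enorm_mul]
        congr 2
        field_simp
    _ = ‖w‖ₑ ^ (-α) * ∫⁻ t in Set.Icc (-R) R, ‖t + c / w‖ₑ ^ (-α) :=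
        lintegral_const_mul' _ _ (by simp [ENNReal.rpow_eq_top_iff, hw₀])
    _ ≤ ‖w‖ₑ ^ (-α) * (J + volume (Set.Icc (-R) R) + 1) := by
        gcongr
        exact (key _).trans le_self_add
    _ = _ := mul_comm _ _

/-- The cube `[-R, R] ^ n`. -/
def cube (n : ℕ) (R : ℝ) : Set (Fin n → ℝ) := Set.univ.pi fun _ => Set.Icc (-R) R

theorem volume_cube_ne_top (n : ℕ) (R : ℝ) : volume (cube n R) ≠ ∞ := by
  simp only [cube, volume_pi_pi, Real.volume_Icc]
  exact ENNReal.prod_ne_top fun _ _ => ENNReal.ofReal_ne_top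

/-- Negative moments over a cube of a linear form are controlled by each of its coefficients. -/
theorem exists_lintegral_dotProduct_rpow_neg_le {α : ℝ} (hα₀ : 0 < α) (hα : α < 1) (R : ℝ)
    (n : ℕ) : ∃ C : ℝ≥0∞, C ≠ 0 ∧ C ≠ ∞ ∧ ∀ (w : Fin n → ℝ) (j : Fin n),
      ∫⁻ b in cube n R, ‖w ⬝ᵥ b‖ₑ ^ (-α) ≤ C * ‖w j‖ₑ ^ (-α) := by
  obtain ⟨C, hC₀, hC, h⟩ := exists_lintegral_affine_rpow_neg_le hα₀ hα R
  cases n with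
  | zero => exact ⟨1, by simp, by simp, fun w j => j.elim0⟩
  | succ n =>
  refine ⟨C * (volume (cube n R) + 1), by simp [hC₀], ?_, fun w j => ?_⟩
  · exact ENNReal.mul_ne_top hC (by simp [volume_cube_ne_top])
  set μ : Measure ℝ := volume.restrict (Set.Icc (-R) R)
  have hμ (l : ℕ) : (volume : Measure (Fin l → ℝ)).restrict (cube l R) = Measure.pi fun _ => μ := by
    rw [cube, volume_pi, Measure.restrict_pi_pi]
  -- Isolate coordinate `j`: the form is affine in it with slope `w j`, and the other coordinates
  -- only move the intercept.
  have e := measurePreserving_piFinSuccAbove (fun _ : Fin (n + 1) => μ) j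
  rw [hμ, ← (e.symm _).lintegral_comp_emb (MeasurableEquiv.measurableEmbedding _),
    lintegral_prod_symm _ (by fun_prop)]
  calc ∫⁻ y, (∫⁻ x, ‖w ⬝ᵥ (MeasurableEquiv.piFinSuccAbove (fun _ => ℝ) j).symm (x, y)‖ₑ ^ (-α) ∂μ)
          ∂(Measure.pi fun _ : Fin n => μ)
      ≤ ∫⁻ _, C * ‖w j‖ₑ ^ (-α) ∂(Measure.pi fun _ : Fin n => μ) := by
        refine lintegral_mono fun y => ?_
        refine le_of_eq_of_le (lintegral_congr fun x => ?_)
          (h (w j) (∑ i, w (j.succAbove i) * y i))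
        simp [dotProduct, Fin.sum_univ_succAbove _ j]
    _ = C * volume (cube n R) * ‖w j‖ₑ ^ (-α) := by
        rw [lintegral_const, ← hμ, Measure.restrict_apply_univ]; ring
    _ ≤ _ := by
        gcongr
        exact le_self_add

/-- Small-ball estimate: the measure of the pairs `(a, b)` in a product of cubes with
`|aᵀ v b| ≤ δ` is at most of order `δ ^ α`, uniformly over the matrices `v` one of whose entries is
bounded away from zero. -/
theorem exists_volume_bilinear_le {α : ℝ} (hα₀ : 0 < α) (hα : α < 1) (R : ℝ)
    (m n : ℕ) {η : ℝ} (hη : 0 < η) : ∃ C : ℝ≥0∞, C ≠ ∞ ∧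
      ∀ (v : Matrix (Fin m) (Fin n) ℝ) (i : Fin m) (j : Fin n), η ≤ |v i j| → ∀ δ : ℝ, 0 < δ →
        volume {z ∈ cube m R ×ˢ cube n R | |z.1 ⬝ᵥ v.mulVec z.2| ≤ δ}
          ≤ C * ENNReal.ofReal δ ^ α := by
  obtain ⟨C, hC₀, hC, h⟩ := exists_lintegral_dotProduct_rpow_neg_le hα₀ hα R m
  obtain ⟨D, hD₀, hD, h'⟩ := exists_lintegral_dotProduct_rpow_neg_le hα₀ hα R n
  refine ⟨C * (D * ENNReal.ofReal η ^ (-α)), ?_, fun v i j hv δ hδ => ?_⟩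
  · refine ENNReal.mul_ne_top hC (ENNReal.mul_ne_top hD ?_)
    simp [ENNReal.rpow_eq_top_iff, hη]
  set ν := ((volume : Measure (Fin m → ℝ)).restrict (cube m R)).prod
    ((volume : Measure (Fin n → ℝ)).restrict (cube n R))
  have hν : ν = volume.restrict (cube m R ×ˢ cube n R) := by
    rw [Measure.volume_eq_prod, ← Measure.prod_restrict]
  have hmeas : Measurable fun z : (Fin m → ℝ) × (Fin n → ℝ) =>
      ‖z.1 ⬝ᵥ v.mulVec z.2‖ₑ ^ (-α) := by
    have : Continuous fun z : (Fin m → ℝ) × (Fin n → ℝ) => z.1 ⬝ᵥ v.mulVec z.2 := by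
      simp only [dotProduct, Matrix.mulVec]; fun_prop
    exact this.measurable.enorm.pow_const _
  have hmoment : ∫⁻ z, ‖z.1 ⬝ᵥ v.mulVec z.2‖ₑ ^ (-α) ∂ν ≤ C * (D * ENNReal.ofReal η ^ (-α)) := by
    rw [lintegral_prod_symm _ hmeas.aemeasurable]
    -- Integrating over `a` leaves the `i`-th coefficient of `v b`, itself a linear form in `b` with
    -- `j`-th coefficient `v i j`.
    calc ∫⁻ b in cube n R, ∫⁻ a in cube m R, ‖a ⬝ᵥ v.mulVec b‖ₑ ^ (-α)
        ≤ ∫⁻ b in cube n R, C * ‖v i ⬝ᵥ b‖ₑ ^ (-α) := by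
          refine lintegral_mono fun b => ?_
          simp_rw [dotProduct_comm _ (v.mulVec b)]
          exact h (v.mulVec b) i
      _ = C * ∫⁻ b in cube n R, ‖v i ⬝ᵥ b‖ₑ ^ (-α) := lintegral_const_mul' _ _ hC
      _ ≤ C * (D * ‖v i j‖ₑ ^ (-α)) := by gcongr; exact h' _ _
      _ ≤ C * (D * ENNReal.ofReal η ^ (-α)) := by
          gcongr C * (D * ?_)
          refine ennreal_rpow_neg_anti hα₀.le ?_
          rw [Real.enorm_eq_ofReal_abs]
          exact ENNReal.ofReal_le_ofReal hv
  have hset : {z ∈ cube m R ×ˢ cube n R | |z.1 ⬝ᵥ v.mulVec z.2| ≤ δ} ⊆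
      {z | ENNReal.ofReal δ ^ (-α) ≤ ‖z.1 ⬝ᵥ v.mulVec z.2‖ₑ ^ (-α)} ∩ cube m R ×ˢ cube n R := by
    rintro z ⟨hz, hzδ⟩
    refine ⟨ennreal_rpow_neg_anti hα₀.le ?_, hz⟩
    rw [Real.enorm_eq_ofReal_abs]
    exact ENNReal.ofReal_le_ofReal hzδ
  refine (measure_mono hset).trans ?_
  set U := {z : (Fin m → ℝ) × (Fin n → ℝ) | ENNReal.ofReal δ ^ (-α) ≤ ‖z.1 ⬝ᵥ v.mulVec z.2‖ₑ ^ (-α)}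
  rw [← Measure.restrict_apply (measurableSet_le measurable_const hmeas), ← hν]
  have hmk := (mul_meas_ge_le_lintegral (μ := ν) hmeas (ENNReal.ofReal δ ^ (-α))).trans hmoment
  have hδ₀ : ENNReal.ofReal δ ≠ 0 := by simpa using hδ
  calc ν U = ENNReal.ofReal δ ^ α * (ENNReal.ofReal δ ^ (-α) * ν U) := by
        rw [← mul_assoc, ← ENNReal.rpow_add _ _ hδ₀ ENNReal.ofReal_ne_top]; simp
    _ ≤ ENNReal.ofReal δ ^ α * (C * (D * ENNReal.ofReal η ^ (-α))) := by gcongr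
    _ = _ := mul_comm _ _

/-! ### Norm bounds and covering numbers -/

theorem abs_entry_le_frobenius_norm {m n : ℕ} (w : Matrix (Fin m) (Fin n) ℝ) (i : Fin m)
    (j : Fin n) : |w i j| ≤ ‖w‖ := by
  rw [Matrix.frobenius_norm_def, ← Real.sqrt_eq_rpow]
  refine Real.abs_le_sqrt ?_
  have h₁ : ‖w i j‖ ^ (2 : ℝ) ≤ ∑ l, ‖w i l‖ ^ (2 : ℝ) :=
    Finset.single_le_sum (f := fun l => ‖w i l‖ ^ (2 : ℝ)) (fun _ _ => by positivity)
      (Finset.mem_univ j)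
  have h₂ : ∑ l, ‖w i l‖ ^ (2 : ℝ) ≤ ∑ r, ∑ l, ‖w r l‖ ^ (2 : ℝ) :=
    Finset.single_le_sum (f := fun r => ∑ l, ‖w r l‖ ^ (2 : ℝ)) (fun _ _ => by positivity)
      (Finset.mem_univ i)
  refine le_trans (le_of_eq ?_) (h₁.trans h₂)
  rw [Real.rpow_two, Real.norm_eq_abs, sq_abs]

theorem abs_bilinear_le {m n : ℕ} {R : ℝ} (w : Matrix (Fin m) (Fin n) ℝ)
    {a : Fin m → ℝ} {b : Fin n → ℝ} (ha : a ∈ cube m R) (hb : b ∈ cube n R) :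
    |a ⬝ᵥ w.mulVec b| ≤ m * n * R ^ 2 * ‖w‖ := by
  have ha' (i) : |a i| ≤ R := abs_le.2 (ha i trivial)
  have hb' (j) : |b j| ≤ R := abs_le.2 (hb j trivial)
  have hrow (i : Fin m) : |w.mulVec b i| ≤ n * (‖w‖ * R) := by
    calc |w.mulVec b i| ≤ ∑ j, |w i j * b j| := by
          rw [Matrix.mulVec, dotProduct]
          exact Finset.abs_sum_le_sum_abs _ _
      _ ≤ ∑ _j : Fin n, ‖w‖ * R := Finset.sum_le_sum fun j _ => by
          rw [abs_mul]
          exact mul_le_mul (abs_entry_le_frobenius_norm w i j) (hb' j) (abs_nonneg _)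
            (norm_nonneg _)
      _ = n * (‖w‖ * R) := by simp
  calc |a ⬝ᵥ w.mulVec b| ≤ ∑ i, |a i * w.mulVec b i| := Finset.abs_sum_le_sum_abs _ _
    _ ≤ ∑ _i : Fin m, R * (n * (‖w‖ * R)) := Finset.sum_le_sum fun i _ => by
        rw [abs_mul]
        exact mul_le_mul (ha' i) (hrow i) (abs_nonneg _) ((abs_nonneg _).trans (ha' i))
    _ = m * n * R ^ 2 * ‖w‖ := by simp; ring

instance matrixProperSpace {m n : ℕ} : ProperSpace (Matrix (Fin m) (Fin n) ℝ) :=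
  letI : NormedSpace ℝ (Matrix (Fin m) (Fin n) ℝ) := Matrix.frobeniusNormedSpace
  FiniteDimensional.proper ℝ _

theorem exists_cover_of_coveringNumber {m n : ℕ} {S : Set (Matrix (Fin m) (Fin n) ℝ)}
    (hS : Bornology.IsBounded S) {ρ : ℝ} (hρ : 0 < ρ) :
    ∃ M : Fin (coveringNumber S ρ) → Matrix (Fin m) (Fin n) ℝ, S ⊆ ⋃ i, Metric.ball (M i) ρ := by
  refine Nat.sInf_mem (s := {N : ℕ | ∃ M : Fin N → Matrix (Fin m) (Fin n) ℝ,
    S ⊆ ⋃ i, Metric.ball (M i) ρ}) ?_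
  obtain ⟨t, ht, hcov⟩ := Metric.totallyBounded_iff.1
    (hS.isCompact_closure.totallyBounded.subset subset_closure) ρ hρ
  refine ⟨_, fun i => (ht.toFinset.equivFin.symm i : Matrix (Fin m) (Fin n) ℝ), fun x hx => ?_⟩
  obtain ⟨y, hy, hxy⟩ := Set.mem_iUnion₂.1 (hcov hx)
  exact Set.mem_iUnion.2 ⟨ht.toFinset.equivFin ⟨y, ht.mem_toFinset.2 hy⟩, by simpa using hxy⟩

/-- A bound on a lower limit controls only some arbitrarily small radii, which is enough for a limit
argument. -/
theorem frequently_coveringNumber_le {m n : ℕ} {S : Set (Matrix (Fin m) (Fin n) ℝ)} {s : ℝ}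
    (h : lowerMinkowskiDim S < (s : EReal)) :
    ∃ᶠ ρ in 𝓝[>] (0 : ℝ), (coveringNumber S ρ : ℝ) ≤ ρ ^ (-s) := by
  have hsmall : ∀ᶠ ρ in 𝓝[>] (0 : ℝ), ρ ∈ Set.Ioo (0 : ℝ) 1 :=
    Ioo_mem_nhdsGT one_pos
  refine ((frequently_lt_of_liminf_lt (by isBoundedDefault) h).and_eventually hsmall).mono ?_
  rintro ρ ⟨hlt, hρ₀, hρ₁⟩
  rw [EReal.coe_lt_coe_iff, one_div, Real.log_inv] at hlt
  have hlog : 0 < -Real.log ρ := neg_pos.2 (Real.log_neg hρ₀ hρ₁)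
  rw [div_lt_iff₀ hlog] at hlt
  rcases Nat.eq_zero_or_pos (coveringNumber S ρ) with h₀ | h₀
  · rw [h₀]; simpa using Real.rpow_nonneg hρ₀.le _
  · rw [Real.le_rpow_iff_log_le (by exact_mod_cast h₀) hρ₀]
    linarith

/-! ### Collisions with a fixed matrix -/

/-- For a fixed matrix `x`, almost no family of measurement vectors in a cube fails to separate `x`
from the points of `closure S` differing from `x` by at least `η` in a given entry. -/
theorem volume_collision_eq_zero {m n k : ℕ} {S : Set (Matrix (Fin m) (Fin n) ℝ)}
    (hS : Bornology.IsBounded S) (hk : lowerMinkowskiDim S < ((k : ℝ) : EReal))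
    (x : Matrix (Fin m) (Fin n) ℝ) (i : Fin m) (j : Fin n) {η : ℝ} (hη : 0 < η) (R : ℝ) :
    volume {q : Fin k → (Fin m → ℝ) × (Fin n → ℝ) | (∀ l, q l ∈ cube m R ×ˢ cube n R) ∧
      ∃ u ∈ closure S, η ≤ |(u - x) i j| ∧ ∀ l, (q l).1 ⬝ᵥ (u - x).mulVec (q l).2 = 0} = 0 := by
  obtain ⟨s, hs, hsk⟩ := EReal.lt_iff_exists_real_btwn.1 hk
  rw [EReal.coe_lt_coe_iff] at hsk
  obtain ⟨α, hα₀, hα₁, hα⟩ : ∃ α : ℝ, 0 < α ∧ α < 1 ∧ s < α * k := by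
    have hlim : Tendsto (fun α : ℝ => α * k) (𝓝[<] 1) (𝓝 (1 * k)) :=
      (Continuous.tendsto (by fun_prop) _).mono_left nhdsWithin_le_nhds
    have h₁ := hlim.eventually (lt_mem_nhds (by simpa using hsk))
    have h₂ : ∀ᶠ α in 𝓝[<] (1 : ℝ), α ∈ Set.Ioo (0 : ℝ) 1 := Ioo_mem_nhdsLT one_pos
    obtain ⟨α, h, hα₀, hα₁⟩ := (h₁.and h₂).exists
    exact ⟨α, hα₀, hα₁, h⟩
  obtain ⟨C, hC, hsb⟩ := exists_volume_bilinear_le hα₀ hα₁ R m n hη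
  -- The `2` comes from the diameter of a `ρ`-ball; the `1` keeps `c` positive in degenerate cases.
  set c : ℝ := 2 * (m * n * R ^ 2) + 1
  have hc : 0 < c := by positivity
  set B := {q : Fin k → (Fin m → ℝ) × (Fin n → ℝ) | (∀ l, q l ∈ cube m R ×ˢ cube n R) ∧
      ∃ u ∈ closure S, η ≤ |(u - x) i j| ∧ ∀ l, (q l).1 ⬝ᵥ (u - x).mulVec (q l).2 = 0}
  have hbound {ρ : ℝ} (hρ : 0 < ρ) :
      volume B ≤ coveringNumber S ρ * (C * ENNReal.ofReal (c * ρ) ^ α) ^ k := by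
    obtain ⟨M, hM⟩ := exists_cover_of_coveringNumber hS hρ
    have hM' : closure S ⊆ ⋃ r, Metric.closedBall (M r) ρ :=
      closure_minimal (hM.trans (Set.iUnion_mono fun r => Metric.ball_subset_closedBall))
        (isClosed_iUnion_of_finite fun r => Metric.isClosed_closedBall)
    set D : Fin (coveringNumber S ρ) → Set (Fin k → (Fin m → ℝ) × (Fin n → ℝ)) := fun r =>
      {q | (∀ l, q l ∈ cube m R ×ˢ cube n R) ∧ ∃ u ∈ Metric.closedBall (M r) ρ,
        η ≤ |(u - x) i j| ∧ ∀ l, (q l).1 ⬝ᵥ (u - x).mulVec (q l).2 = 0}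
    have hBD : B ⊆ ⋃ r, D r := by
      rintro q ⟨hq, u, hu, hu'⟩
      obtain ⟨r, hr⟩ := Set.mem_iUnion.1 (hM' hu)
      exact Set.mem_iUnion.2 ⟨r, hq, u, hr, hu'⟩
    have hD (r) : volume (D r) ≤ (C * ENNReal.ofReal (c * ρ) ^ α) ^ k := by
      -- The center may be too close to `x` for the small-ball estimate, so an `η`-far point of the
      -- ball replaces it.
      by_cases hr : ∃ u ∈ Metric.closedBall (M r) ρ, η ≤ |(u - x) i j|
      · obtain ⟨v, hv, hvη⟩ := hr
        have hsub : D r ⊆ Set.univ.pi fun _ : Fin k =>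
            {z ∈ cube m R ×ˢ cube n R | |z.1 ⬝ᵥ (v - x).mulVec z.2| ≤ c * ρ} := by
          rintro q ⟨hq, u, hu, -, h₀⟩ l -
          refine ⟨hq l, ?_⟩
          have huv : ‖v - u‖ ≤ 2 * ρ := by
            rw [← dist_eq_norm]
            refine (dist_triangle_right _ _ (M r)).trans ?_
            rw [Metric.mem_closedBall] at hv hu
            linarith
          have hdiff : (q l).1 ⬝ᵥ (v - x).mulVec (q l).2 = (q l).1 ⬝ᵥ (v - u).mulVec (q l).2 := by
            rw [← sub_add_sub_cancel v u x, Matrix.add_mulVec, dotProduct_add, h₀ l, add_zero]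
          rw [hdiff]
          refine (abs_bilinear_le _ (hq l).1 (hq l).2).trans ?_
          calc (m * n * R ^ 2 * ‖v - u‖ : ℝ) ≤ m * n * R ^ 2 * (2 * ρ) := by gcongr
            _ ≤ c * ρ := by simp only [c]; linarith
        refine (measure_mono hsub).trans ?_
        rw [volume_pi_pi, Finset.prod_const, Finset.card_univ, Fintype.card_fin]
        gcongr
        exact hsb (v - x) i j hvη _ (by positivity)
      · have : D r = ∅ := by
          refine Set.eq_empty_of_forall_notMem ?_
          rintro q ⟨-, u, hu, hu', -⟩
          exact hr ⟨u, hu, hu'⟩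
        simp [this]
    calc volume B ≤ ∑ r, volume (D r) := (measure_mono hBD).trans (measure_iUnion_fintype_le _ _)
      _ ≤ ∑ _r : Fin (coveringNumber S ρ), (C * ENNReal.ofReal (c * ρ) ^ α) ^ k :=
          Finset.sum_le_sum fun r _ => hD r
      _ = _ := by simp
  have hlim : Tendsto (fun ρ : ℝ => (C * ENNReal.ofReal c ^ α) ^ k *
      ENNReal.ofReal (ρ ^ (α * k - s))) (𝓝[>] 0) (𝓝 0) := by
    have h₁ : Tendsto (fun ρ : ℝ => ρ ^ (α * k - s)) (𝓝[>] 0) (𝓝 0) := by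
      have := (Real.continuousAt_rpow_const 0 (α * k - s) (Or.inr (by linarith))).tendsto
      rw [Real.zero_rpow (by linarith)] at this
      exact this.mono_left nhdsWithin_le_nhds
    have h₂ := ENNReal.Tendsto.const_mul (a := (C * ENNReal.ofReal c ^ α) ^ k)
      (ENNReal.tendsto_ofReal h₁) (Or.inr (ENNReal.pow_ne_top (ENNReal.mul_ne_top hC
        (ENNReal.rpow_ne_top_of_nonneg hα₀.le ENNReal.ofReal_ne_top))))
    simpa using h₂
  refine le_antisymm (ge_of_tendsto_of_frequently hlim ?_) zero_le
  refine ((frequently_coveringNumber_le hs).and_eventually self_mem_nhdsWithin).mono ?_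
  rintro ρ ⟨hN, hρ⟩
  have hρ : 0 < ρ := hρ
  calc volume B ≤ coveringNumber S ρ * (C * ENNReal.ofReal (c * ρ) ^ α) ^ k := hbound hρ
    _ ≤ ENNReal.ofReal (ρ ^ (-s)) * (C * ENNReal.ofReal (c * ρ) ^ α) ^ k := by
        gcongr
        rw [← ENNReal.ofReal_natCast]
        exact ENNReal.ofReal_le_ofReal hN
    _ = (C * ENNReal.ofReal c ^ α) ^ k *
          (ENNReal.ofReal (ρ ^ (-s)) * (ENNReal.ofReal ρ ^ α) ^ k) := by
        rw [ENNReal.ofReal_mul hc.le, ENNReal.mul_rpow_of_nonneg _ _ hα₀.le]; ring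
    _ = _ := by
        rw [ENNReal.ofReal_rpow_of_pos hρ, ← ENNReal.ofReal_pow (by positivity),
          ← ENNReal.ofReal_mul (by positivity), ← Real.rpow_mul_natCast hρ.le,
          ← Real.rpow_add hρ, neg_add_eq_sub]

/-! ### Measurability of collisions and almost sure separation -/

theorem measurements_rankOne {m n k : ℕ} (a : Fin k → Fin m → ℝ) (b : Fin k → Fin n → ℝ)
    (w : Matrix (Fin m) (Fin n) ℝ) :
    measurements (rankOne a b) w = fun l => a l ⬝ᵥ w.mulVec (b l) := by
  funext l
  simp only [measurements, traceInner, rankOne, Matrix.transpose_vecMulVec,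
    Matrix.vecMulVec_mul, Matrix.trace_vecMulVec, Matrix.dotProduct_mulVec]
  rw [dotProduct_comm]

/-- The pairs of measurement vectors and a matrix `x` such that the measurements do not distinguish
`x` from some point of `K` differing from `x` by at least `η` in the entry `(i, j)`. -/
def collisionSet {m n : ℕ} (k : ℕ) (K : Set (Matrix (Fin m) (Fin n) ℝ)) (i : Fin m) (j : Fin n)
    (η : ℝ) :
    Set (((Fin k → Fin m → ℝ) × (Fin k → Fin n → ℝ)) × Matrix (Fin m) (Fin n) ℝ) :=
  {z | ∃ u ∈ K, η ≤ |(u - z.2) i j| ∧ ∀ l, z.1.1 l ⬝ᵥ (u - z.2).mulVec (z.1.2 l) = 0}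

instance matrixPolishSpace {m n : ℕ} : PolishSpace (Matrix (Fin m) (Fin n) ℝ) :=
  inferInstanceAs (PolishSpace (Fin m → Fin n → ℝ))

/-- Projection along a compact factor is a closed map. Closedness gives the measurability that
Tonelli needs. -/
theorem isClosed_collisionSet {m n : ℕ} (k : ℕ) {K : Set (Matrix (Fin m) (Fin n) ℝ)}
    (hK : IsCompact K) (i : Fin m) (j : Fin n) (η : ℝ) : IsClosed (collisionSet k K i j η) := by
  have : CompactSpace K := isCompact_iff_compactSpace.1 hK
  have hE (i : Fin m) (j : Fin n) : Continuous fun z : (((Fin k → Fin m → ℝ) × (Fin k → Fin n → ℝ))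
      × Matrix (Fin m) (Fin n) ℝ) × K => ((z.2 : Matrix (Fin m) (Fin n) ℝ) - z.1.2) i j :=
    Continuous.matrix_elem (by fun_prop) i j
  have hclosed : IsClosed {z : (((Fin k → Fin m → ℝ) × (Fin k → Fin n → ℝ)) ×
      Matrix (Fin m) (Fin n) ℝ) × K | η ≤ |((z.2 : Matrix (Fin m) (Fin n) ℝ) - z.1.2) i j| ∧
        ∀ l, z.1.1.1 l ⬝ᵥ ((z.2 : Matrix (Fin m) (Fin n) ℝ) - z.1.2).mulVec (z.1.1.2 l) = 0} := by
    refine (isClosed_le continuous_const (hE i j).abs).and ?_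
    rw [Set.ofPred_forall]
    refine isClosed_iInter fun l => isClosed_eq ?_ continuous_const
    simp only [dotProduct, Matrix.mulVec]
    refine continuous_finsetSum _ fun i _ => Continuous.mul (by fun_prop) ?_
    exact continuous_finsetSum _ fun j _ => (hE i j).mul (by fun_prop)
  convert isClosedMap_fst_of_compactSpace _ hclosed using 1
  ext z
  exact ⟨fun ⟨u, hu, h⟩ => ⟨(z, ⟨u, hu⟩), h, rfl⟩, by rintro ⟨⟨_, u⟩, h, rfl⟩; exact ⟨u, u.2, h⟩⟩

theorem ae_notMem_collisionSet {m n k : ℕ} {S : Set (Matrix (Fin m) (Fin n) ℝ)}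
    (hS : Bornology.IsBounded S) (hk : lowerMinkowskiDim S < ((k : ℝ) : EReal))
    (x : Matrix (Fin m) (Fin n) ℝ) (i : Fin m) (j : Fin n) {η : ℝ} (hη : 0 < η) :
    ∀ᵐ p : (Fin k → Fin m → ℝ) × (Fin k → Fin n → ℝ), (p, x) ∉ collisionSet k (closure S) i j η := by
  have e := volume_measurePreserving_arrowProdEquivProdArrow (Fin m → ℝ) (Fin n → ℝ) (Fin k)
  rw [← e.map_eq, (MeasurableEquiv.measurableEmbedding _).ae_map_iff, ae_iff]
  -- Cubes of natural size exhaust the space.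
  refine measure_mono_null (fun q hq => ?_)
    (measure_iUnion_null fun R : ℕ => volume_collision_eq_zero hS hk x i j hη R)
  obtain ⟨u, hu, hu', h₀⟩ := not_not.1 hq
  obtain ⟨R, hR⟩ := exists_nat_ge ‖q‖
  refine Set.mem_iUnion.2 ⟨R, fun l => ⟨fun r _ => abs_le.1 ?_, fun r _ => abs_le.1 ?_⟩,
    u, hu, hu', h₀⟩
  · exact (((norm_le_pi_norm (q l).1 r).trans (norm_fst_le _)).trans (norm_le_pi_norm q l)).trans hR
  · exact (((norm_le_pi_norm (q l).2 r).trans (norm_snd_le _)).trans (norm_le_pi_norm q l)).trans hR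

/-! ### Decoding -/

/-- A measurable left inverse on a Borel set of a continuous map that is injective there. -/
theorem exists_measurable_leftInvOn {α β : Type*} [TopologicalSpace α] [PolishSpace α]
    [MeasurableSpace α] [BorelSpace α] [Nonempty α] [TopologicalSpace β] [T2Space β]
    [SecondCountableTopology β] [MeasurableSpace β] [BorelSpace β] {f : α → β} {s : Set α}
    (hs : MeasurableSet s) (hf : ContinuousOn f s) (hinj : Set.InjOn f s) :
    ∃ g : β → α, Measurable g ∧ Set.LeftInvOn g f s := by
  -- Lusin–Souslin: an injective continuous map on a Borel subset of a Polish space is a measurable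
  -- embedding.
  obtain ⟨g, hg, hgf⟩ := (hf.measurableEmbedding hs hinj).exists_measurable_extend
    (measurable_subtype_coe (p := (· ∈ s))) fun _ => inferInstance
  exact ⟨g, hg, fun x hx => congrFun hgf ⟨x, hx⟩⟩

end MatrixCompletion

theorem theorem2 {Ω : Type*} [MeasurableSpace Ω] (P : Measure Ω) [IsProbabilityMeasure P]
    {m n k : ℕ} (X : Ω → Matrix (Fin m) (Fin n) ℝ) (hX : Measurable X)
    (ε : ℝ) (hε : 0 ≤ ε) (S : Set (Matrix (Fin m) (Fin n) ℝ))
    (hS : MatrixCompletion.IsSupportSet P X ε S)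
    (hk : MatrixCompletion.lowerMinkowskiDim S < ((k : ℝ) : EReal)) :
    ∀ᵐ p : (Fin k → Fin m → ℝ) × (Fin k → Fin n → ℝ) ∂volume,
      ∃ g : (Fin k → ℝ) → Matrix (Fin m) (Fin n) ℝ, Measurable g ∧
        MatrixCompletion.AchievesErrorProbability P X
          (MatrixCompletion.rankOne p.1 p.2) g ε := by
  open MatrixCompletion in
  have hK : IsCompact (closure S) := hS.isBounded.isCompact_closure
  set D : Set (((Fin k → Fin m → ℝ) × (Fin k → Fin n → ℝ)) × Matrix (Fin m) (Fin n) ℝ) :=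
    ⋃ (i : Fin m) (j : Fin n) (N : ℕ), collisionSet k (closure S) i j (1 / ((N : ℝ) + 1))
  have hD : MeasurableSet D := .iUnion fun i => .iUnion fun j => .iUnion fun N =>
    (isClosed_collisionSet k hK i j _).measurableSet
  have hDnull : ∀ᵐ p : (Fin k → Fin m → ℝ) × (Fin k → Fin n → ℝ), ∀ᵐ x ∂(P.map X), (p, x) ∉ D := by
    have : IsProbabilityMeasure (P.map X) := Measure.isProbabilityMeasure_map hX.aemeasurable
    refine (Measure.ae_ae_comm (p := fun x p => (p, x) ∉ D)
      (measurable_swap hD.compl)).1 (ae_of_all _ fun x => ?_)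
    have hall : ∀ᵐ p : (Fin k → Fin m → ℝ) × (Fin k → Fin n → ℝ), ∀ i j, ∀ N : ℕ,
        (p, x) ∉ collisionSet k (closure S) i j (1 / ((N : ℝ) + 1)) :=
      ae_all_iff.2 fun i => ae_all_iff.2 fun j => ae_all_iff.2 fun N =>
        ae_notMem_collisionSet hS.isBounded hk x i j (by positivity)
    filter_upwards [hall] with p hp hpD
    obtain ⟨i, hi⟩ := Set.mem_iUnion.1 hpD
    obtain ⟨j, hj⟩ := Set.mem_iUnion.1 hi
    obtain ⟨N, hN⟩ := Set.mem_iUnion.1 hj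
    exact hp i j N hN
  filter_upwards [hDnull] with p hp
  have hcont : Continuous (measurements (rankOne p.1 p.2)) := by
    rw [funext (measurements_rankOne p.1 p.2)]
    simp only [dotProduct, Matrix.mulVec]
    refine continuous_pi fun l => continuous_finsetSum _ fun i _ => continuous_const.mul ?_
    exact continuous_finsetSum _ fun j _ => (continuous_id.matrix_elem i j).mul continuous_const
  -- `S` need not be Borel; its closure is, and contains `X` with at least the same probability.
  set K := closure S ∩ {x | (p, x) ∉ D}
  have hKmeas : MeasurableSet K :=
    isClosed_closure.measurableSet.inter (measurable_prodMk_left hD.compl)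
  have hinj : Set.InjOn (measurements (rankOne p.1 p.2)) K := by
    rintro x ⟨-, hxD⟩ u ⟨hu, -⟩ hxu
    by_contra hne
    obtain ⟨i, j, hij⟩ : ∃ i j, u i j ≠ x i j := by
      by_contra! h
      exact hne (Matrix.ext h).symm
    obtain ⟨N, hN⟩ := exists_nat_one_div_lt (abs_pos.2 (sub_ne_zero.2 hij))
    refine hxD (Set.mem_iUnion.2 ⟨i, Set.mem_iUnion.2 ⟨j, Set.mem_iUnion.2
      ⟨N, u, hu, hN.le, fun l => ?_⟩⟩⟩)
    simp only [measurements_rankOne] at hxu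
    rw [Matrix.sub_mulVec, dotProduct_sub, ← congrFun hxu l, sub_self]
  obtain ⟨g, hg, hgl⟩ := exists_measurable_leftInvOn hKmeas hcont.continuousOn hinj
  refine ⟨g, hg, ?_⟩
  have hpX : P {ω | (p, X ω) ∈ D} = 0 := by
    have := ae_of_ae_map hX.aemeasurable hp
    simpa [ae_iff] using this
  have hSm : MeasurableSet {ω | X ω ∈ closure S} := hX isClosed_closure.measurableSet
  calc P.real {ω | g (measurements (rankOne p.1 p.2) (X ω)) ≠ X ω}
      ≤ P.real ({ω | X ω ∈ closure S}ᶜ ∪ {ω | (p, X ω) ∈ D}) := by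
        refine measureReal_mono fun ω hω => ?_
        by_contra h
        simp only [Set.mem_union, Set.mem_compl_iff, Set.mem_ofPred_eq, not_or, not_not] at h
        exact hω (hgl ⟨h.1, h.2⟩)
    _ ≤ P.real {ω | X ω ∈ closure S}ᶜ + P.real {ω | (p, X ω) ∈ D} := measureReal_union_le _ _
    _ = 1 - P.real {ω | X ω ∈ closure S} := by
        rw [probReal_compl_eq_one_sub hSm, measureReal_def P {ω | (p, X ω) ∈ D}, hpX]; simp
    _ ≤ ε := by
        have h : P.real {ω | X ω ∈ S} ≤ P.real {ω | X ω ∈ closure S} :=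
          measureReal_mono fun ω hω => subset_closure hω
        linarith [hS.one_sub_le]
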